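/- Let $d\ge 1$, $N\ge 2$, $m\ge 1$. For an order-$d$ tensor $T\in\mathbb{R}^{N\times\cdots\times N}$, with entries indexed by $[N]^d$, let $\|T\|_\infty=\max_\omega|T(\omega)|$, let $\|T\|_F^2=\sum_\omega T(\omega)^2$, and let $$\|T\|_M=\inf\{t>0:\ T\in t\,\mathrm{conv}(T_\pm)\},\qquad T_\pm=\{X\in\{\pm1\}^{N\times\cdots\times N}:\ \mathrm{rank}(X)=1\},$$ where rank is the CP rank. There is an absolute constant $0<C<20$ such that the following holds for all $d\geq 1$, $N\geq 2$, $m\geq 1$. Let $\sigma>0$, $R\ge\alpha$, and let $T^\sharp$ satisfy $\|T^\sharp\|_\infty\le\alpha$ and $\|T^\sharp\|_M\le R$. Let $\Pi=\{\pi_\omega\}$ be an arbitrary probability distribution on $[N]^d$, let $\omega_1,\dots,\omega_m$ be i.i.d. with law $\Pi$, let $\xi_1,\dots,\xi_m$ be i.i.d. standard normal random variables independent of $(\omega_1,\dots,\omega_m)$, and let $Y_t=T^\sharp(\omega_t)+\sigma\xi_t$. Let $\hat T$ be a minimizer of $\frac1m\sum_{t=1}^m (X(\omega_t)-Y_t)^2$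 over all $X$ with $\|X\|_\infty\le\alpha$ and $\|X\|_M\le R$. Then (1) with probability greater than $1-e^{-N/\ln N}-e^{-dN}$, every such minimizer satisfies $$\|\hat T-T^\sharp\|_\Pi^2:=\sum_\omega\pi_\omega\big(\hat T(\omega)-T^\sharp(\omega)\big)^2\le C\big(\sigma(R+\alpha)+R\alpha\big)\sqrt{\frac{dN}{m}};$$ (2) if moreover $\mu\ge1$, $\pi_\omega\ge\frac{1}{\mu N^d}$ for all $\omega\in[N]^d$, and $m>dN$, then with probability greater than $1-e^{-N/\ln N}-e^{-dN}$, every such minimizer satisfies $$\frac1{N^d}\|\hat T-T^\sharp\|_F^2\le C\mu(\alpha+\sigma)R\sqrt{\frac{dN}{m}}.$$ -/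

import Mathlib

open MeasureTheory ProbabilityTheory

noncomputable section

/-- Real tensors of order `d` and size `N × ⋯ × N`.  As a function type on a finite index set it
carries the sup norm, so `‖T‖` is the entrywise infinity norm of `T`. -/
abbrev Tensor (d N : ℕ) : Type := (Fin d → Fin N) → ℝ

/-- Unit tensors: outer products `u₁ ∘ ⋯ ∘ u_d` of Euclidean unit vectors. -/
def IsUnitTensor {d N : ℕ} (U : Tensor d N) : Prop :=
  ∃ u : Fin d → EuclideanSpace ℝ (Fin N),
    (∀ j, ‖u j‖ = 1) ∧ ∀ i, U i = ∏ j, u j (i j)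

/-- The (CP) rank: the least number of scalar multiples of unit tensors with sum `T`. -/
def tensorRank {d N : ℕ} (T : Tensor d N) : ℕ :=
  sInf {r : ℕ | ∃ (c : Fin r → ℝ) (U : Fin r → Tensor d N),
    (∀ k, IsUnitTensor (U k)) ∧ T = ∑ k, c k • U k}

/-- The atoms: sign tensors of rank one. -/
def rankOneSignTensors (d N : ℕ) : Set (Tensor d N) :=
  {T | (∀ i, T i = 1 ∨ T i = -1) ∧ tensorRank T = 1}

/-- The atomic M-norm `inf {t > 0 : T ∈ t • conv (rank-one sign tensors)}`. -/
def mNorm {d N : ℕ} (T : Tensor d N) : ℝ :=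
  gauge (convexHull ℝ (rankOneSignTensors d N)) T

/-- Tensors with infinity norm at most `α` and M-norm at most `R`. -/
def mNormBall (d N : ℕ) (α R : ℝ) : Set (Tensor d N) :=
  {T | ‖T‖ ≤ α ∧ mNorm T ≤ R}

/-- The noisy observation `T(ω) + σ ξ` of the entry with index `ω`. -/
def observation {d N : ℕ} (T : Tensor d N) (σ : ℝ) (ω : Fin d → Fin N) (ξ : ℝ) : ℝ :=
  T ω + σ * ξ

/-- The empirical squared loss `(1/m) ∑ₜ (X(ωₜ) - Yₜ)²`. -/
def empiricalLoss {d N m : ℕ} (ω : Fin m → Fin d → Fin N) (Y : Fin m → ℝ) (X : Tensor d N) : ℝ :=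
  (1 / (m : ℝ)) * ∑ t, (X (ω t) - Y t) ^ 2

/-- `That` is a minimizer of the empirical loss over the tensors with infinity norm at most `α`
and M-norm at most `R`. -/
def IsMNormLSEstimator {d N m : ℕ} (α R : ℝ) (ω : Fin m → Fin d → Fin N) (Y : Fin m → ℝ)
    (That : Tensor d N) : Prop :=
  That ∈ mNormBall d N α R ∧ IsMinOn (empiricalLoss ω Y) (mNormBall d N α R) That

/-- The squared norm `‖T‖²_Π = ∑_ω π_ω T(ω)²` weighted by the sampling distribution. -/
def weightedSqNorm {d N : ℕ} (p : PMF (Fin d → Fin N)) (T : Tensor d N) : ℝ :=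
  ∑ i, (p i).toReal * T i ^ 2

/-- The squared Frobenius norm. -/
def frobeniusSqNorm {d N : ℕ} (T : Tensor d N) : ℝ :=
  ∑ i, T i ^ 2

end

/-!
Write `E` and `E_m` for the population and the empirical mean over the sampled indices, `Δ = X - T`
for the error of the estimator `X`, and `q = √(dN / m)`. Then `‖Δ‖²_Π = (E - E_m) Δ² + E_m Δ²`, and
the whole theorem follows from `‖Δ‖²_Π ≤ 19.4 (σ R + α R) q`.

* `E_m Δ²`: minimality of `X` bounds this by `(2 σ / m) ∑ ξ_t Δ(ω_t)`. Linear functionals on an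
  M-norm ball are controlled by their values at the `2 ^ (dN)` sign tensors
  (`exists_signTensor_le`), where the noise is Gaussian conditionally on the sample; a union bound
  gives `16 σ R q`.
* `(E - E_m) Δ²`: split `Δ² = (X² - 2 T X) + T²`. The last summand does not depend on `X`, and
  Hoeffding's inequality gives `α² q ≤ α R q`. The first is treated by an exponential moment: by
  symmetrization, and contraction of `x ↦ x² - 2 T x` (which vanishes at `0` and is `4 α`-Lipschitz
  on `[-α, α]`), its supremum over the constraint set is dominated by that of
  `8 α m⁻¹ ∑ ε_t X(ω_t)`, hence by sign tensors again, which gives `18.4 α R q`. Splitting off `T²`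
  is what keeps the constant below `20`, since contracting `Δ²` directly would put `Δ`, of M-norm up
  to `2 R`, in place of `X`.

Suprema are avoided throughout the symmetrization and contraction: every inequality is stated for an
arbitrary choice of a point of the constraint set as a function of the sample (and the signs), and
asserts the existence of another choice for which the right-hand side is at least as large. In this
form the one-coordinate statement `exists_symmetrization_contraction` tensorizes by induction
(`exists_tensorization`).
-/

/-! ### Symmetrization and contraction for exponential moments -/

/-- Two-point contraction inequality, with `u` nonnegative because of `hp`: the pair `(s, u)`,
`(t, -v)` on the right-hand side competes with `(t, v)`, `(s, -u)`, and the larger of `u` and `v`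
decides when both are nonnegative. -/
lemma exp_two_point_of_nonneg {s t u v p q : ℝ} (hp : |p| ≤ u) (hq : |q| ≤ |v|)
    (hpq : |p - q| ≤ |u - v|) (h₁ : t + q ≤ s + p) (h₂ : s - p ≤ t - q) :
    Real.exp (s + p) + Real.exp (t - q) ≤ Real.exp (s + u) + Real.exp (t - v) ∨
      Real.exp (s + p) + Real.exp (t - q) ≤ Real.exp (t + v) + Real.exp (s - u) := by
  have key : ∀ {x y δ ε : ℝ}, x ≤ y → 0 ≤ δ → δ ≤ ε →
      Real.exp (x + δ) - Real.exp x ≤ Real.exp (y + ε) - Real.exp y := by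
    intro x y δ ε hxy hδ hδε
    have h1 : Real.exp x ≤ Real.exp y := Real.exp_le_exp.2 hxy
    have h2 : Real.exp δ ≤ Real.exp ε := Real.exp_le_exp.2 hδε
    have h3 : 1 ≤ Real.exp δ := Real.one_le_exp hδ
    rw [Real.exp_add, Real.exp_add]
    nlinarith [Real.exp_pos x, Real.exp_pos y]
  obtain ⟨hp₁, hp₂⟩ := abs_le.1 hp
  obtain ⟨hq₁, hq₂⟩ := abs_le.1 hq
  obtain ⟨hd₁, hd₂⟩ := abs_le.1 hpq
  rcases le_total 0 v with hv | hv
  · rw [abs_of_nonneg hv] at hq₁ hq₂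
    rcases le_total v u with huv | huv
    · rw [abs_of_nonneg (sub_nonneg.2 huv)] at hd₁ hd₂
      left
      have := key (x := t - v) (y := s + p) (δ := v - q) (ε := u - p)
        (by linarith) (by linarith) (by linarith)
      rw [show t - v + (v - q) = t - q by ring, show s + p + (u - p) = s + u by ring] at this
      linarith
    · rw [abs_of_nonpos (sub_nonpos.2 huv)] at hd₁ hd₂
      right
      have := key (x := s - u) (y := t - q) (δ := p + u) (ε := v + q)
        (by linarith) (by linarith) (by linarith)
      rw [show s - u + (p + u) = s + p by ring, show t - q + (v + q) = t + v by ring] at this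
      linarith
  · rw [abs_of_nonpos hv] at hq₁ hq₂
    left
    exact add_le_add (Real.exp_le_exp.2 (by linarith)) (Real.exp_le_exp.2 (by linarith))

/-- Two-point contraction: a contraction `g` of `h` (vanishing where `h` does) may be replaced by
`h` under a Rademacher sign inside an exponential, at the price of changing the two points at which
the functions are evaluated. This is the contraction principle without suprema. -/
lemma exists_exp_contraction {β : Type*} (a g h : β → ℝ) (hgh : ∀ x, |g x| ≤ |h x|)
    (hlip : ∀ x y, |g x - g y| ≤ |h x - h y|) (x y : β) :
    ∃ x' y', Real.exp (a x + g x) + Real.exp (a y - g y) ≤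
      Real.exp (a x' + h x') + Real.exp (a y' - h y') := by
  have single : ∀ z, Real.exp (a z + g z) + Real.exp (a z - g z) ≤
      Real.exp (a z + h z) + Real.exp (a z - h z) := by
    intro z
    have h1 := Real.cosh_le_cosh.2 (hgh z)
    rw [Real.cosh_eq, Real.cosh_eq] at h1
    simp only [sub_eq_add_neg, Real.exp_add]
    nlinarith [Real.exp_pos (a z)]
  rcases lt_or_ge (a x + g x) (a y + g y) with h₁ | h₁
  · exact ⟨y, y, (add_le_add_left (Real.exp_le_exp.2 h₁.le) _).trans (single y)⟩
  rcases lt_or_ge (a y - g y) (a x - g x) with h₂ | h₂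
  · exact ⟨x, x, (add_le_add_right (Real.exp_le_exp.2 h₂.le) _).trans (single x)⟩
  rcases le_total 0 (h x) with hx | hx
  · rcases exp_two_point_of_nonneg ((hgh x).trans_eq (abs_of_nonneg hx)) (hgh y) (hlip x y)
      h₁ h₂ with H | H
    exacts [⟨x, y, H⟩, ⟨y, x, H⟩]
  rcases le_total (h y) 0 with hy | hy
  -- The map `(s, t, u, v) ↦ (t, s, -v, -u)` reduces this case to the previous one.
  · rcases exp_two_point_of_nonneg (s := a y) (t := a x) (u := -h y) (v := -h x) (p := -g y)
      (q := -g x) (by rw [abs_neg]; exact (hgh y).trans_eq (abs_of_nonpos hy))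
      (by simpa using hgh x) (by simpa [neg_add_eq_sub] using hlip x y)
      (by linarith) (by linarith) with H | H
    · refine ⟨x, y, ?_⟩
      simp only [sub_neg_eq_add, ← sub_eq_add_neg] at H
      linarith
    · refine ⟨y, x, ?_⟩
      simp only [sub_neg_eq_add, ← sub_eq_add_neg] at H
      linarith
  · have h3 := hgh x
    have h4 := hgh y
    rw [abs_of_nonpos hx] at h3
    rw [abs_of_nonneg hy] at h4
    refine ⟨y, x, ?_⟩
    rw [add_comm]
    exact add_le_add (Real.exp_le_exp.2 (by linarith [neg_abs_le (g y)]))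
      (Real.exp_le_exp.2 (by linarith [le_abs_self (g x)]))

/-- Symmetrization and contraction in one coordinate: the centred variable `E f - f_i` is replaced
by `2 ε h_i` with a Rademacher sign `ε`. -/
lemma exists_symmetrization_contraction {ι β : Type*} [Fintype ι] [Nonempty ι] (p : ι → ℝ)
    (hp : ∀ i, 0 ≤ p i) (hp1 : ∑ i, p i = 1) (f h : ι → β → ℝ)
    (hfh : ∀ i x, |f i x| ≤ |h i x|) (hlip : ∀ i x y, |f i x - f i y| ≤ |h i x - h i y|)
    (a : β → ℝ) (Y : ι → β) :
    ∃ Z : ι × ℤˣ → β,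
      ∑ i, p i * Real.exp (a (Y i) + (∑ j, p j * f j (Y i) - f i (Y i))) ≤
        ∑ v : ι × ℤˣ, p v.1 / 2 * Real.exp (a (Z v) + 2 * ((v.2 : ℤ) : ℝ) * h v.1 (Z v)) := by
  -- Jensen's inequality, then `exp (b - c) ≤ (exp (2 b) + exp (-2 c)) / 2`.
  have h1 : ∀ i, Real.exp (a (Y i) + (∑ j, p j * f j (Y i) - f i (Y i))) ≤
      ∑ j, p j *
        ((Real.exp (a (Y i) + 2 * f j (Y i)) + Real.exp (a (Y i) - 2 * f i (Y i))) / 2) := by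
    intro i
    have hJ := convexOn_exp.map_sum_le (t := Finset.univ) (w := p)
      (p := fun j => a (Y i) + (f j (Y i) - f i (Y i))) (fun j _ => hp j) hp1
      (fun _ _ => Set.mem_univ _)
    simp only [smul_eq_mul, mul_add, mul_sub, Finset.sum_add_distrib, Finset.sum_sub_distrib,
      ← Finset.sum_mul, hp1, one_mul] at hJ
    refine hJ.trans (Finset.sum_le_sum fun j _ => mul_le_mul_of_nonneg_left ?_ (hp j))
    set b := Real.exp (a (Y i) / 2 + f j (Y i))
    set c := Real.exp (a (Y i) / 2 - f i (Y i))
    have e1 : Real.exp (a (Y i) + (f j (Y i) - f i (Y i))) = b * c := by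
      rw [← Real.exp_add]; ring_nf
    have e2 : Real.exp (a (Y i) + 2 * f j (Y i)) = b * b := by rw [← Real.exp_add]; ring_nf
    have e3 : Real.exp (a (Y i) - 2 * f i (Y i)) = c * c := by rw [← Real.exp_add]; ring_nf
    rw [e1, e2, e3]
    nlinarith [sq_nonneg (b - c)]
  -- The point at which the ghost sample is evaluated may be chosen as the best one.
  choose k hk using fun j => Finite.exists_max fun i => a (Y i) + 2 * f j (Y i)
  choose x' y' hxy using fun i => exists_exp_contraction a (fun z => 2 * f i z)
    (fun z => 2 * h i z) (fun z => by simpa [abs_mul] using hfh i z)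
    (fun z z' => by simpa [abs_mul, ← mul_sub] using hlip i z z') (Y (k i)) (Y i)
  refine ⟨fun v => if v.2 = 1 then x' v.1 else y' v.1, ?_⟩
  calc _ ≤ ∑ i, p i * ∑ j, p j * ((Real.exp (a (Y (k j)) + 2 * f j (Y (k j))) +
          Real.exp (a (Y i) - 2 * f i (Y i))) / 2) := by
        refine Finset.sum_le_sum fun i _ => mul_le_mul_of_nonneg_left ((h1 i).trans ?_) (hp i)
        refine Finset.sum_le_sum fun j _ => mul_le_mul_of_nonneg_left ?_ (hp j)
        have := Real.exp_le_exp.2 (hk j i)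
        linarith
    _ = ∑ i, p i / 2 * (Real.exp (a (Y (k i)) + 2 * f i (Y (k i))) +
          Real.exp (a (Y i) - 2 * f i (Y i))) := by
        simp only [add_div, mul_add, Finset.sum_add_distrib, ← Finset.sum_mul, hp1, one_mul]
        congr 1
        · exact Finset.sum_congr rfl fun i _ => by ring
        · exact Finset.sum_congr rfl fun i _ => by ring
    _ ≤ ∑ i, p i / 2 * (Real.exp (a (x' i) + 2 * h i (x' i)) +
          Real.exp (a (y' i) - 2 * h i (y' i))) :=
        Finset.sum_le_sum fun i _ => mul_le_mul_of_nonneg_left (hxy i) (by linarith [hp i])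
    _ = _ := by
        rw [Fintype.sum_prod_type]
        refine Finset.sum_congr rfl fun i _ => ?_
        rw [show (Finset.univ : Finset ℤˣ) = {1, -1} from rfl, Finset.sum_pair (by decide)]
        simp [mul_add, show (-1 : ℤˣ) ≠ 1 by decide, ← sub_eq_add_neg]

/-- A one-coordinate comparison of exponential moments, valid for every additive perturbation `a`
and every choice of evaluation points, tensorizes to `m` independent coordinates. -/
lemma exists_tensorization {ι κ β : Type*} [Fintype ι] [Fintype κ] (p : ι → ℝ) (q : κ → ℝ)
    (hp : ∀ i, 0 ≤ p i) (hq : ∀ i, 0 ≤ q i) (D : ι → β → ℝ) (k : κ → β → ℝ)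
    (H : ∀ (a : β → ℝ) (Y : ι → β), ∃ Z : κ → β,
      ∑ i, p i * Real.exp (a (Y i) + D i (Y i)) ≤ ∑ v, q v * Real.exp (a (Z v) + k v (Z v)))
    (m : ℕ) (a : β → ℝ) (Y : (Fin m → ι) → β) :
    ∃ Z : (Fin m → κ) → β,
      ∑ w : Fin m → ι, (∏ t, p (w t)) * Real.exp (a (Y w) + ∑ t, D (w t) (Y w)) ≤
        ∑ v : Fin m → κ, (∏ t, q (v t)) * Real.exp (a (Z v) + ∑ t, k (v t) (Z v)) := by
  induction m generalizing a with
  | zero => exact ⟨fun _ => Y default, by simp [Subsingleton.elim default (Fin.elim0 : Fin 0 → ι)]⟩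
  | succ m ih =>
    choose Z₁ hZ₁ using fun i => ih (fun x => a x + D i x) (fun w => Y (Fin.cons i w))
    choose Z₂ hZ₂ using fun v : Fin m → κ =>
      H (fun x => a x + ∑ t, k (v t) x) (fun i => Z₁ i v)
    refine ⟨fun v => Z₂ (Fin.tail v) (v 0), ?_⟩
    rw [← (Fin.consEquiv fun _ => ι).sum_comp, ← (Fin.consEquiv fun _ => κ).sum_comp,
      Fintype.sum_prod_type, Fintype.sum_prod_type_right]
    simp only [Fin.consEquiv, Equiv.coe_fn_mk, Fin.prod_univ_succ, Fin.sum_univ_succ,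
      Fin.cons_zero, Fin.cons_succ, Fin.tail_cons]
    calc _ = ∑ i, p i * ∑ w : Fin m → ι, (∏ t, p (w t)) *
            Real.exp (a (Y (Fin.cons i w)) + D i (Y (Fin.cons i w)) +
              ∑ t, D (w t) (Y (Fin.cons i w))) := by
          simp only [Finset.mul_sum, mul_assoc, add_assoc]
      _ ≤ ∑ i, p i * ∑ v : Fin m → κ, (∏ t, q (v t)) *
            Real.exp (a (Z₁ i v) + D i (Z₁ i v) + ∑ t, k (v t) (Z₁ i v)) :=
          Finset.sum_le_sum fun i _ => mul_le_mul_of_nonneg_left (hZ₁ i) (hp i)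
      _ = ∑ v : Fin m → κ, (∏ t, q (v t)) * ∑ i, p i *
            Real.exp (a (Z₁ i v) + ∑ t, k (v t) (Z₁ i v) + D i (Z₁ i v)) := by
          simp only [Finset.mul_sum]
          rw [Finset.sum_comm]
          refine Finset.sum_congr rfl fun v _ => Finset.sum_congr rfl fun i _ => ?_
          rw [add_right_comm]; ring
      _ ≤ ∑ v : Fin m → κ, (∏ t, q (v t)) * ∑ c, q c *
            Real.exp (a (Z₂ v c) + ∑ t, k (v t) (Z₂ v c) + k c (Z₂ v c)) :=
          Finset.sum_le_sum fun v _ => mul_le_mul_of_nonneg_left (hZ₂ v)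
            (Finset.prod_nonneg fun t _ => hq _)
      _ = _ := by
          simp only [Finset.mul_sum]
          refine Finset.sum_congr rfl fun v _ => Finset.sum_congr rfl fun i _ => ?_
          rw [add_assoc, add_comm (∑ t, k (v t) _)]; ring

/-! ### Rank-one sign tensors and the M-norm -/

/-- The outer product of the sign vectors `s 0, …, s (d - 1)`, each given as a
function into `ℤˣ`. -/
def signTensor {d N : ℕ} (s : Fin d → Fin N → ℤˣ) : Tensor d N :=
  fun i => ∏ j, ((s j (i j) : ℤ) : ℝ)

lemma signTensor_eq_one_or {d N : ℕ} (s : Fin d → Fin N → ℤˣ) (i : Fin d → Fin N) :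
    signTensor s i = 1 ∨ signTensor s i = -1 := by
  have h : signTensor s i = (((∏ j, s j (i j) : ℤˣ) : ℤ) : ℝ) := by
    simp [signTensor, Units.coe_prod]
  rcases Int.units_eq_one_or (∏ j, s j (i j)) with h' | h' <;> simp [h, h']

lemma neg_signTensor {d N : ℕ} (hd : 1 ≤ d) (s : Fin d → Fin N → ℤˣ) :
    ∃ s' : Fin d → Fin N → ℤˣ, signTensor s' = -signTensor s := by
  have : NeZero d := ⟨by omega⟩
  refine ⟨fun j => if j = 0 then -s j else s j, funext fun i => ?_⟩
  have h : ∀ j : Fin d, ((((if j = 0 then -s j else s j) (i j) : ℤˣ) : ℤ) : ℝ) =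
      (if j = 0 then (-1 : ℝ) else 1) * ((s j (i j) : ℤ) : ℝ) := by
    intro j; split_ifs <;> simp
  simp only [signTensor, h, Finset.prod_mul_distrib, Finset.prod_ite_eq', Finset.mem_univ, if_true,
    Pi.neg_apply, neg_mul, one_mul]

lemma signTensor_mem_rankOneSignTensors {d N : ℕ} (hN : 1 ≤ N) (s : Fin d → Fin N → ℤˣ) :
    signTensor s ∈ rankOneSignTensors d N := by
  refine ⟨signTensor_eq_one_or s, ?_⟩
  have hN' : 0 < √(N : ℝ) := Real.sqrt_pos.2 (by exact_mod_cast hN)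
  have hmem : (1 : ℕ) ∈ {r : ℕ | ∃ (c : Fin r → ℝ) (U : Fin r → Tensor d N),
      (∀ k, IsUnitTensor (U k)) ∧ signTensor s = ∑ k, c k • U k} := by
    refine ⟨fun _ => √(N : ℝ) ^ d, fun _ => fun i => ∏ j, ((√(N : ℝ))⁻¹ * ((s j (i j) : ℤ) : ℝ)),
      fun _ => ⟨fun j => WithLp.toLp 2 fun k => (√(N : ℝ))⁻¹ * ((s j k : ℤ) : ℝ), fun j => ?_,
        fun i => rfl⟩, funext fun i => ?_⟩
    · have hs : ∀ k, (((s j k : ℤˣ) : ℤ) : ℝ) ^ 2 = 1 := by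
        intro k; rcases Int.units_eq_one_or (s j k) with h | h <;> simp [h]
      rw [EuclideanSpace.norm_eq]
      simp only [Real.norm_eq_abs, sq_abs, mul_pow, hs, mul_one, inv_pow,
        Real.sq_sqrt (Nat.cast_nonneg N), Finset.sum_const, Finset.card_univ, Fintype.card_fin,
        nsmul_eq_mul]
      rw [mul_inv_cancel₀ (by positivity), Real.sqrt_one]
    · simp only [signTensor, Finset.univ_unique, Finset.sum_const, Finset.card_singleton, one_smul,
        Pi.smul_apply, smul_eq_mul, Finset.prod_mul_distrib, Finset.prod_const, Finset.card_univ,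
        Fintype.card_fin]
      rw [← mul_assoc, ← mul_pow, mul_inv_cancel₀ hN'.ne', one_pow, one_mul]
  refine le_antisymm (Nat.sInf_le hmem) (Nat.one_le_iff_ne_zero.2 fun h0 => ?_)
  have h0' := Nat.sInf_mem ⟨1, hmem⟩
  rw [show sInf _ = 0 from h0] at h0'
  obtain ⟨c, U, -, hU⟩ := h0'
  have h1 : signTensor s (fun _ => ⟨0, hN⟩) = 0 := by simp [hU]
  rcases signTensor_eq_one_or s (fun _ => ⟨0, hN⟩) with h | h <;> rw [h] at h1 <;> norm_num at h1

/-- A sign tensor of rank one is `c • U` with `U` an outer product; replacing every factor by its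
sign, and `c` by its sign, does not change the entries. -/
lemma exists_signTensor_of_mem {d N : ℕ} (hd : 1 ≤ d) {T : Tensor d N}
    (hT : T ∈ rankOneSignTensors d N) : ∃ s : Fin d → Fin N → ℤˣ, T = signTensor s := by
  obtain ⟨hsign, hrank⟩ := hT
  have hne : {r : ℕ | ∃ (c : Fin r → ℝ) (U : Fin r → Tensor d N),
      (∀ k, IsUnitTensor (U k)) ∧ T = ∑ k, c k • U k}.Nonempty := by
    by_contra h
    rw [Set.not_nonempty_iff_eq_empty] at h
    rw [tensorRank, h] at hrank
    simp at hrank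
  have hmem := Nat.sInf_mem hne
  rw [show sInf _ = 1 from hrank] at hmem
  obtain ⟨c, U, hU, hTU⟩ := hmem
  obtain ⟨u, -, hu⟩ := hU 0
  have hT' : ∀ i, T i = c 0 * ∏ j, u j (i j) := by
    intro i; simp [hTU, hu]
  let sgn : ℝ → ℤˣ := fun x => if 0 ≤ x then 1 else -1
  have hsgn : ∀ x : ℝ, x = |x| * ((sgn x : ℤ) : ℝ) := by
    intro x
    by_cases hx : 0 ≤ x
    · simp [sgn, hx, abs_of_nonneg]
    · simp [sgn, hx, abs_of_neg (not_le.1 hx)]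
  have hTs : ∀ i, T i = ((sgn (c 0) : ℤ) : ℝ) * signTensor (fun j k => sgn (u j k)) i := by
    intro i
    have h1 : T i = (|c 0| * ∏ j, |u j (i j)|) *
        (((sgn (c 0) : ℤ) : ℝ) * signTensor (fun j k => sgn (u j k)) i) := by
      rw [hT', signTensor]
      conv_lhs => rw [hsgn (c 0), Finset.prod_congr rfl fun j _ => hsgn (u j (i j)),
        Finset.prod_mul_distrib]
      ring
    have h2 : |c 0| * ∏ j, |u j (i j)| = 1 := by
      have : |T i| = 1 := by rcases hsign i with h | h <;> simp [h]
      rwa [hT', abs_mul, Finset.abs_prod] at this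
    rw [h1, h2, one_mul]
  rcases Int.units_eq_one_or (sgn (c 0)) with h | h
  · exact ⟨fun j k => sgn (u j k), funext fun i => by simp [hTs i, h]⟩
  · obtain ⟨s', hs'⟩ := neg_signTensor hd (fun j k => sgn (u j k))
    exact ⟨s', funext fun i => by simp [hTs i, h, hs']⟩

/-- The coordinate tensors are products of factors `(1 - s) / 2` with `s` a sign vector, so the sign
tensors span. -/
lemma span_range_signTensor (d N : ℕ) :
    Submodule.span ℝ (Set.range (signTensor : (Fin d → Fin N → ℤˣ) → Tensor d N)) = ⊤ := by
  classical
  rw [eq_top_iff]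
  intro x _
  have hx : x = ∑ i, x i • (Pi.single i (1 : ℝ) : Tensor d N) := by
    simpa using pi_eq_sum_univ' x
  rw [hx]
  refine Submodule.sum_mem _ fun i _ => Submodule.smul_mem _ _ ?_
  have hi : (Pi.single i (1 : ℝ) : Tensor d N) = ∑ S ∈ (Finset.univ : Finset (Fin d)).powerset,
      ((1 / 2 : ℝ) ^ d * (-1) ^ S.card) •
        signTensor (fun j k => if j ∈ S ∧ k = i j then -1 else 1) := by
    funext k
    have hS : ∀ S : Finset (Fin d), (1 / 2 : ℝ) ^ d * (-1) ^ S.card *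
        signTensor (fun j l => if j ∈ S ∧ l = i j then -1 else 1) k =
        (1 / 2 : ℝ) ^ d * ∏ j ∈ S, (if k j = i j then 1 else -1) := by
      intro S
      have h1 : ∀ j, ((((if j ∈ S ∧ k j = i j then -1 else 1) : ℤˣ) : ℤ) : ℝ) =
          if j ∈ S then (if k j = i j then (-1 : ℝ) else 1) else 1 := by
        intro j; by_cases h : j ∈ S <;> by_cases h' : k j = i j <;> simp [h, h']
      simp only [signTensor, h1, Finset.prod_ite_mem, Finset.univ_inter]
      rw [mul_assoc, ← Finset.prod_const, ← Finset.prod_mul_distrib]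
      congr 1
      exact Finset.prod_congr rfl fun j _ => by split_ifs <;> norm_num
    simp only [Finset.sum_apply, Pi.smul_apply, smul_eq_mul, hS]
    rw [← Finset.mul_sum, ← Finset.prod_one_add]
    by_cases hk : k = i
    · subst hk
      norm_num [← mul_pow]
    · obtain ⟨j, hj⟩ := Function.ne_iff.1 hk
      rw [Pi.single_eq_of_ne hk, Finset.prod_eq_zero (Finset.mem_univ j) (by simp [hj]), mul_zero]
  rw [hi]
  exact Submodule.sum_mem _ fun S _ => Submodule.smul_mem _ _ (Submodule.subset_span ⟨_, rfl⟩)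

open scoped Pointwise in
lemma exists_mem_smul_convexHull {d N : ℕ} (hd : 1 ≤ d) (hN : 1 ≤ N) (x : Tensor d N) :
    ∃ r : ℝ, 0 < r ∧ x ∈ r • convexHull ℝ (rankOneSignTensors d N) := by
  set A := convexHull ℝ (rankOneSignTensors d N) with hA
  have hconv : Convex ℝ A := convex_convexHull ℝ _
  have hmem : ∀ s, signTensor s ∈ A := fun s =>
    subset_convexHull ℝ _ (signTensor_mem_rankOneSignTensors hN s)
  have hneg : ∀ y ∈ A, -y ∈ A := by
    intro y hy
    have hsymm : -rankOneSignTensors d N = rankOneSignTensors d N := by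
      have hsub : -rankOneSignTensors d N ⊆ rankOneSignTensors d N := by
        intro T hT
        obtain ⟨s, hs⟩ := exists_signTensor_of_mem hd (Set.mem_neg.1 hT)
        obtain ⟨s', hs'⟩ := neg_signTensor hd s
        rw [← neg_neg T, hs, ← hs']
        exact signTensor_mem_rankOneSignTensors hN s'
      exact hsub.antisymm fun T hT => Set.mem_neg.2 (hsub (by simpa using hT))
    rw [hA, ← hsymm, convexHull_neg]
    simpa using hy
  have hzero : (0 : Tensor d N) ∈ A := by
    have h1 := hmem fun _ _ => 1
    have := hconv h1 (hneg _ h1) (a := 1 / 2) (b := 1 / 2) (by norm_num) (by norm_num) (by norm_num)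
    simpa using this
  have hx : x ∈ Submodule.span ℝ (Set.range (signTensor : (Fin d → Fin N → ℤˣ) → Tensor d N)) :=
    span_range_signTensor d N ▸ Submodule.mem_top
  induction hx using Submodule.span_induction with
  | mem x hx =>
    obtain ⟨s, rfl⟩ := hx
    exact ⟨1, one_pos, by simpa using hmem s⟩
  | zero => exact ⟨1, one_pos, by simpa using hzero⟩
  | add x y _ _ hx hy =>
    obtain ⟨a, ha, hxa⟩ := hx
    obtain ⟨b, hb, hyb⟩ := hy
    exact ⟨a + b, by positivity, by
      rw [hconv.add_smul ha.le hb.le]; exact Set.add_mem_add hxa hyb⟩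
  | smul c x _ hx =>
    obtain ⟨a, ha, y, hy, rfl⟩ := hx
    rcases lt_trichotomy c 0 with hc | rfl | hc
    · refine ⟨-c * a, mul_pos (by linarith) ha, -y, hneg y hy, ?_⟩
      simp [smul_smul]
    · exact ⟨1, one_pos, by simpa using hzero⟩
    · exact ⟨c * a, by positivity, y, hy, by simp [smul_smul]⟩

/-- Duality between the M-norm and the sign tensors: a linear functional on the M-norm ball of
radius `R` is at most `R` times its value at a suitable sign tensor. -/
lemma exists_signTensor_le {d N : ℕ} (hd : 1 ≤ d) (hN : 1 ≤ N) (ℓ : Tensor d N →ₗ[ℝ] ℝ) :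
    ∃ s : Fin d → Fin N → ℤˣ, ∀ (R : ℝ) (X : Tensor d N), mNorm X ≤ R →
      ℓ X ≤ R * ℓ (signTensor s) := by
  obtain ⟨s, hs⟩ := Finite.exists_max fun s : Fin d → Fin N → ℤˣ => ℓ (signTensor s)
  refine ⟨s, fun R X hX => ?_⟩
  have hle : ∀ Y ∈ convexHull ℝ (rankOneSignTensors d N), ℓ Y ≤ ℓ (signTensor s) := by
    refine convexHull_min (t := {Y | ℓ Y ≤ ℓ (signTensor s)}) ?_ (convex_halfSpace_le ℓ.isLinear _)
    intro Y hY
    obtain ⟨s', rfl⟩ := exists_signTensor_of_mem hd hY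
    exact hs s'
  have h0 : 0 ≤ ℓ (signTensor s) := by
    obtain ⟨s', hs'⟩ := neg_signTensor hd s
    have := hs s'
    simp only [hs', map_neg] at this
    linarith
  have h1 : ∀ a, R < a → ℓ X ≤ a * ℓ (signTensor s) := by
    intro a ha
    obtain ⟨b, ⟨hb, Y, hY, rfl⟩, hba⟩ := exists_lt_of_csInf_lt
      (exists_mem_smul_convexHull hd hN X) (hX.trans_lt ha)
    simp only [map_smul, smul_eq_mul]
    exact (mul_le_mul_of_nonneg_left (hle Y hY) hb.le).trans (mul_le_mul_of_nonneg_right hba.le h0)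
  by_contra! hlt
  have hM : 0 < ℓ (signTensor s) + 1 := by linarith
  have h2 := h1 (R + (ℓ X - R * ℓ (signTensor s)) / (ℓ (signTensor s) + 1))
    (lt_add_of_pos_right _ (div_pos (by linarith) hM))
  have h3 : (ℓ X - R * ℓ (signTensor s)) / (ℓ (signTensor s) + 1) * (ℓ (signTensor s) + 1) =
      ℓ X - R * ℓ (signTensor s) := div_mul_cancel₀ _ hM.ne'
  have h4 : 0 < (ℓ X - R * ℓ (signTensor s)) / (ℓ (signTensor s) + 1) :=
    div_pos (by linarith) hM
  nlinarith

/-! ### The squared loss under sampling: one-sided uniform deviation -/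

lemma abs_apply_le_of_norm_le {d N : ℕ} {X : Tensor d N} {α : ℝ} (hX : ‖X‖ ≤ α)
    (i : Fin d → Fin N) : |X i| ≤ α :=
  (norm_le_pi_norm X i).trans hX

lemma sum_sign_exp_mul_le {ι : Type*} [Fintype ι] (p : ι → ℝ) (hp1 : ∑ i, p i = 1)
    (u : ι → ℝ) (hu : ∀ i, u i = 1 ∨ u i = -1) (b : ℝ) :
    ∑ v : ι × ℤˣ, p v.1 / 2 * Real.exp (b * ((v.2 : ℤ) : ℝ) * u v.1) ≤ Real.exp (b ^ 2 / 2) := by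
  refine le_of_eq_of_le ?_ (Real.cosh_le_exp_half_sq b)
  rw [Fintype.sum_prod_type, ← one_mul (Real.cosh b), ← hp1, Finset.sum_mul]
  refine Finset.sum_congr rfl fun i _ => ?_
  rw [show (Finset.univ : Finset ℤˣ) = {1, -1} from rfl, Finset.sum_pair (by decide), Real.cosh_eq]
  rcases hu i with h | h <;> simp [h] <;> ring

/-- Exponential moment of the one-sided deviation of the loss `X ↦ (X - T)² - T²`, for an arbitrary
data-dependent choice `X w` in the constraint set. The contraction is onto `4 α X`: the term `T²`
is left out so that the functions vanish at `X = 0`, and only `X` (not `X - T`) is compared with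
sign tensors. -/
lemma sum_prod_mul_exp_deviation_le {d N : ℕ} (hd : 1 ≤ d) (hN : 1 ≤ N)
    (p : (Fin d → Fin N) → ℝ) (hp : ∀ i, 0 ≤ p i) (hp1 : ∑ i, p i = 1) {α R c : ℝ}
    {T : Tensor d N} (hT : ‖T‖ ≤ α) (m : ℕ)
    (X : (Fin m → Fin d → Fin N) → mNormBall d N α R) :
    ∑ w : Fin m → Fin d → Fin N, (∏ t, p (w t)) * Real.exp (∑ t, c *
        (∑ j, p j * ((X w).1 j ^ 2 - 2 * T j * (X w).1 j) -
          ((X w).1 (w t) ^ 2 - 2 * T (w t) * (X w).1 (w t)))) ≤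
      2 ^ (d * N) * Real.exp (m * (8 * c * α * R) ^ 2 / 2) := by
  have hα : 0 ≤ α := (norm_nonneg T).trans hT
  have : Nonempty (Fin d → Fin N) := ⟨fun _ => ⟨0, hN⟩⟩
  let f : (Fin d → Fin N) → mNormBall d N α R → ℝ := fun i x => c * (x.1 i ^ 2 - 2 * T i * x.1 i)
  let h : (Fin d → Fin N) → mNormBall d N α R → ℝ := fun i x => 4 * c * α * x.1 i
  have hlip : ∀ i x y, |f i x - f i y| ≤ |h i x - h i y| := by
    intro i x y
    have h1 : f i x - f i y = c * ((x.1 i - y.1 i) * (x.1 i + y.1 i - 2 * T i)) := by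
      simp only [f]; ring
    have h2 : h i x - h i y = c * ((x.1 i - y.1 i) * (4 * α)) := by simp only [h]; ring
    rw [h1, h2, abs_mul, abs_mul, abs_mul c, abs_mul _ (4 * α)]
    refine mul_le_mul_of_nonneg_left (mul_le_mul_of_nonneg_left ?_ (abs_nonneg _)) (abs_nonneg _)
    rw [abs_of_nonneg (by positivity : 0 ≤ 4 * α)]
    have hx := abs_le.1 (abs_apply_le_of_norm_le x.2.1 i)
    have hy := abs_le.1 (abs_apply_le_of_norm_le y.2.1 i)
    have ht := abs_le.1 (abs_apply_le_of_norm_le hT i)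
    exact abs_le.2 ⟨by linarith, by linarith⟩
  have hfh : ∀ i x, |f i x| ≤ |h i x| := by
    intro i x
    have h1 : f i x = c * (x.1 i * (x.1 i - 2 * T i)) := by simp only [f]; ring
    have h2 : h i x = c * (x.1 i * (4 * α)) := by simp only [h]; ring
    rw [h1, h2, abs_mul, abs_mul, abs_mul c, abs_mul _ (4 * α)]
    refine mul_le_mul_of_nonneg_left (mul_le_mul_of_nonneg_left ?_ (abs_nonneg _)) (abs_nonneg _)
    rw [abs_of_nonneg (by positivity : 0 ≤ 4 * α)]
    have hx := abs_le.1 (abs_apply_le_of_norm_le x.2.1 i)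
    have ht := abs_le.1 (abs_apply_le_of_norm_le hT i)
    exact abs_le.2 ⟨by linarith, by linarith⟩
  obtain ⟨Z, hZ⟩ := exists_tensorization p (fun v : (Fin d → Fin N) × ℤˣ => p v.1 / 2) hp
    (fun v => by linarith [hp v.1]) (fun i x => ∑ j, p j * f j x - f i x)
    (fun v x => 2 * ((v.2 : ℤ) : ℝ) * h v.1 x)
    (exists_symmetrization_contraction p hp hp1 f h hfh hlip) m (fun _ => 0) X
  calc _ = ∑ w : Fin m → Fin d → Fin N, (∏ t, p (w t)) *
          Real.exp (0 + ∑ t, (∑ j, p j * f j (X w) - f (w t) (X w))) := by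
        refine Finset.sum_congr rfl fun w _ => ?_
        rw [zero_add]
        congr 2
        refine Finset.sum_congr rfl fun t _ => ?_
        simp only [f, mul_sub, Finset.mul_sum, Finset.sum_sub_distrib]
        congr 2 <;> exact Finset.sum_congr rfl fun j _ => by ring
    _ ≤ _ := hZ
    _ ≤ ∑ v : Fin m → (Fin d → Fin N) × ℤˣ, (∏ t, p (v t).1 / 2) *
          ∑ s : Fin d → Fin N → ℤˣ, Real.exp (∑ t,
            8 * c * α * R * (((v t).2 : ℤ) : ℝ) * signTensor s (v t).1) := by
        refine Finset.sum_le_sum fun v _ => mul_le_mul_of_nonneg_left ?_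
          (Finset.prod_nonneg fun t _ => by linarith [hp (v t).1])
        let ℓ : Tensor d N →ₗ[ℝ] ℝ := ∑ t, (8 * c * α * (((v t).2 : ℤ) : ℝ)) •
          LinearMap.proj (v t).1
        have hℓ : ∀ Y, ℓ Y = ∑ t, 8 * c * α * (((v t).2 : ℤ) : ℝ) * Y (v t).1 := by
          intro Y; simp [ℓ]
        obtain ⟨s, hs⟩ := exists_signTensor_le hd hN ℓ
        refine le_trans (Real.exp_le_exp.2 ?_) (Finset.single_le_sum
          (f := fun s => Real.exp (∑ t,
            8 * c * α * R * (((v t).2 : ℤ) : ℝ) * signTensor s (v t).1))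
          (fun s _ => (Real.exp_pos _).le) (Finset.mem_univ s))
        have h1 := hs R (Z v).1 (Z v).2.2
        rw [hℓ, hℓ, Finset.mul_sum] at h1
        rw [zero_add]
        refine le_of_eq_of_le ?_ (h1.trans_eq ?_)
        · exact Finset.sum_congr rfl fun t _ => by simp only [h]; ring
        · exact Finset.sum_congr rfl fun t _ => by ring
    _ = ∑ s : Fin d → Fin N → ℤˣ, (∑ v : (Fin d → Fin N) × ℤˣ, p v.1 / 2 *
          Real.exp (8 * c * α * R * ((v.2 : ℤ) : ℝ) * signTensor s v.1)) ^ m := by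
        simp only [Finset.mul_sum, Real.exp_sum, ← Finset.prod_mul_distrib]
        rw [Finset.sum_comm]
        refine Finset.sum_congr rfl fun s _ => ?_
        rw [Fintype.sum_pow (fun v : (Fin d → Fin N) × ℤˣ => p v.1 / 2 *
          Real.exp (8 * c * α * R * ((v.2 : ℤ) : ℝ) * signTensor s v.1)) m]
    _ ≤ ∑ s : Fin d → Fin N → ℤˣ, Real.exp ((8 * c * α * R) ^ 2 / 2) ^ m := by
        refine Finset.sum_le_sum fun s _ => pow_le_pow_left₀ ?_
          (sum_sign_exp_mul_le p hp1 _ (signTensor_eq_one_or s) _) m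
        exact Finset.sum_nonneg fun v _ =>
          mul_nonneg (by linarith [hp v.1]) (Real.exp_pos _).le
    _ = _ := by
        rw [Finset.sum_const, nsmul_eq_mul, ← Real.exp_nat_mul, mul_div_assoc]
        simp [pow_mul, mul_comm d N]

/-- The samples on which some `X` in the constraint set has `(E - E_m)((X - T)² - T²) > r`, where
`E` and `E_m` are the population and the empirical mean. -/
def deviationSet {d N : ℕ} (p : (Fin d → Fin N) → ℝ) (α R : ℝ) (T : Tensor d N) (m : ℕ) (r : ℝ) :
    Set (Fin m → Fin d → Fin N) :=
  {w | ∃ X ∈ mNormBall d N α R, m * r < ∑ t, (∑ j, p j * (X j ^ 2 - 2 * T j * X j) -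
    (X (w t) ^ 2 - 2 * T (w t) * X (w t)))}

open Classical in
lemma sum_deviationSet_le {d N : ℕ} (hd : 1 ≤ d) (hN : 1 ≤ N)
    (p : (Fin d → Fin N) → ℝ) (hp : ∀ i, 0 ≤ p i) (hp1 : ∑ i, p i = 1) {α R r : ℝ}
    (hα : 0 < α) (hR : 0 < R) (hr : 0 ≤ r) {T : Tensor d N} (hT : ‖T‖ ≤ α) (hTR : mNorm T ≤ R)
    (m : ℕ) :
    ∑ w with w ∈ deviationSet p α R T m r, ∏ t, p (w t) ≤
      2 ^ (d * N) * Real.exp (-(m * r ^ 2 / (128 * α ^ 2 * R ^ 2))) := by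
  -- The minimizer over `c` of the Chernoff exponent `m (8 c α R)² / 2 - c m r`.
  set c := r / (64 * α ^ 2 * R ^ 2) with hc
  have hc0 : 0 ≤ c := by positivity
  let X : (Fin m → Fin d → Fin N) → mNormBall d N α R := fun w =>
    if h : w ∈ deviationSet p α R T m r then ⟨h.choose, h.choose_spec.1⟩ else ⟨T, hT, hTR⟩
  have h1 := sum_prod_mul_exp_deviation_le hd hN p hp hp1 (c := c) hT m X
  have hprod : ∀ w : Fin m → Fin d → Fin N, 0 ≤ ∏ t, p (w t) :=
    fun w => Finset.prod_nonneg fun t _ => hp _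
  have h2 : (∑ w with w ∈ deviationSet p α R T m r, ∏ t, p (w t)) * Real.exp (c * (m * r)) ≤
      2 ^ (d * N) * Real.exp (m * (8 * c * α * R) ^ 2 / 2) := by
    refine le_trans ?_ h1
    rw [Finset.sum_mul]
    refine le_trans (Finset.sum_le_sum fun w hw => ?_) (Finset.sum_le_sum_of_subset_of_nonneg
      (Finset.filter_subset _ _) fun w _ _ => mul_nonneg (hprod w) (Real.exp_pos _).le)
    have hw' : w ∈ deviationSet p α R T m r := (Finset.mem_filter.1 hw).2
    refine mul_le_mul_of_nonneg_left (Real.exp_le_exp.2 ?_) (hprod w)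
    rw [← Finset.mul_sum]
    refine mul_le_mul_of_nonneg_left ?_ hc0
    have := hw'.choose_spec.2.le
    simpa only [X, dif_pos hw'] using this
  rw [← le_div_iff₀ (Real.exp_pos _), mul_div_assoc, ← Real.exp_sub] at h2
  refine h2.trans_eq ?_
  congr 2
  rw [hc]
  field_simp
  ring

/-! ### Probability bounds for the sample and the noise -/

lemma sum_toReal_pmf {ι : Type*} [Fintype ι] (p : PMF ι) : ∑ i, (p i).toReal = 1 := by
  rw [← ENNReal.toReal_sum fun i _ => p.apply_ne_top i, ← tsum_fintype (L := .unconditional ι),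
    p.tsum_coe, ENNReal.toReal_one]

lemma measureReal_sum_gaussian_ge_le {Ω : Type*} [MeasurableSpace Ω]
    {P : Measure Ω} {m : ℕ} [IsProbabilityMeasure P] {ξ : Fin m → Ω → ℝ}
    (hξ : ∀ t, HasLaw (ξ t) (gaussianReal 0 1) P) (hind : iIndepFun ξ P) (a : Fin m → ℝ)
    (ha : ∀ t, a t = 1 ∨ a t = -1) {r : ℝ} (hr : 0 ≤ r) :
    P.real {x | r ≤ ∑ t, a t * ξ t x} ≤ Real.exp (-r ^ 2 / (2 * m)) := by
  have hsub : ∀ t, HasSubgaussianMGF (fun x => a t * ξ t x) 1 P := by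
    intro t
    have h0 : HasSubgaussianMGF (ξ t) 1 P := by
      refine ⟨fun s => ?_, fun s => ?_⟩
      · have h := integrable_exp_mul_gaussianReal (μ := 0) (v := 1) s
        rw [← (hξ t).map_eq] at h
        exact h.comp_aemeasurable (hξ t).aemeasurable
      · rw [mgf_gaussianReal (hξ t).map_eq]; simp
    have h1 := h0.const_mul (a t)
    convert h1 using 1
    refine NNReal.eq ?_
    change (1 : ℝ) = a t ^ 2 * 1
    rcases ha t with h | h <;> simp [h]
  have hind' : iIndepFun (fun t x => a t * ξ t x) P :=
    hind.comp (fun t y => a t * y) fun t => measurable_const_mul _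
  simpa using HasSubgaussianMGF.measure_sum_ge_le_of_iIndepFun hind' (s := Finset.univ)
    (fun t _ => hsub t) hr

section Probability

variable {ι Ω : Type*} [MeasurableSpace ι] [MeasurableSingletonClass ι]
  [MeasurableSpace Ω] {P : Measure Ω} {m : ℕ} {p : PMF ι} {ω : Fin m → Ω → ι}

lemma measureReal_sample_eq (hω : ∀ t, HasLaw (ω t) p.toMeasure P) (hind : iIndepFun ω P)
    (w : Fin m → ι) : P.real {x | (fun t => ω t x) = w} = ∏ t, (p (w t)).toReal := by
  have h1 : {x | (fun t => ω t x) = w} = ⋂ t ∈ (Finset.univ : Finset (Fin m)), ω t ⁻¹' {w t} := by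
    ext x; simp [funext_iff]
  rw [Measure.real, h1, hind.measure_inter_preimage_eq_mul _ fun t _ => measurableSet_singleton _,
    ENNReal.toReal_prod]
  refine Finset.prod_congr rfl fun t _ => ?_
  rw [← Measure.map_apply_of_aemeasurable (hω t).aemeasurable (measurableSet_singleton _),
    (hω t).map_eq, PMF.toMeasure_apply_singleton _ _ (measurableSet_singleton _)]

open Classical in
lemma measureReal_sample_mem_le [Fintype ι] (hω : ∀ t, HasLaw (ω t) p.toMeasure P)
    (hind : iIndepFun ω P) (B : Set (Fin m → ι)) :
    P.real {x | (fun t => ω t x) ∈ B} ≤ ∑ w with w ∈ B, ∏ t, (p (w t)).toReal := by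
  have h1 : {x | (fun t => ω t x) ∈ B} = ⋃ w ∈ Finset.univ.filter (· ∈ B),
      {x | (fun t => ω t x) = w} := by
    ext x; simp
  rw [h1]
  refine (measureReal_biUnion_finset_le _ _).trans (Finset.sum_le_sum fun w _ => ?_)
  rw [measureReal_sample_eq hω hind]

/-- Union bound over a finite family of sign functions: conditionally on the sample, each sum
`∑ ξ_t u(ω_t)` is centred Gaussian with variance `m`. -/
lemma measureReal_exists_sum_noise_ge_le [Fintype ι] [IsProbabilityMeasure P] {ξ : Fin m → Ω → ℝ}
    (hω : ∀ t, HasLaw (ω t) p.toMeasure P) (hωind : iIndepFun ω P)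
    (hξ : ∀ t, HasLaw (ξ t) (gaussianReal 0 1) P) (hξind : iIndepFun ξ P)
    (hind : IndepFun (fun x t => ω t x) (fun x t => ξ t x) P)
    {κ : Type*} [Fintype κ] (u : κ → ι → ℝ) (hu : ∀ s i, u s i = 1 ∨ u s i = -1)
    {r : ℝ} (hr : 0 ≤ r) :
    P.real {x | ∃ s, r ≤ ∑ t, u s (ω t x) * ξ t x} ≤
      Fintype.card κ * Real.exp (-r ^ 2 / (2 * m)) := by
  have hsub : {x | ∃ s, r ≤ ∑ t, u s (ω t x) * ξ t x} ⊆
      ⋃ s, ⋃ w : Fin m → ι, (fun x t => ω t x) ⁻¹' {w} ∩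
        (fun x t => ξ t x) ⁻¹' {y | r ≤ ∑ t, u s (w t) * y t} := by
    rintro x ⟨s, hs⟩
    exact Set.mem_iUnion₂.2 ⟨s, fun t => ω t x, rfl, hs⟩
  have hterm : ∀ s w, P.real ((fun x t => ω t x) ⁻¹' {w} ∩
      (fun x t => ξ t x) ⁻¹' {y | r ≤ ∑ t, u s (w t) * y t}) ≤
      (∏ t, (p (w t)).toReal) * Real.exp (-r ^ 2 / (2 * m)) := by
    intro s w
    have hmeas : MeasurableSet {y : Fin m → ℝ | r ≤ ∑ t, u s (w t) * y t} :=
      measurableSet_le measurable_const (by fun_prop)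
    rw [Measure.real, hind.measure_inter_preimage_eq_mul _ _ (measurableSet_singleton w) hmeas,
      ENNReal.toReal_mul]
    refine mul_le_mul (measureReal_sample_eq hω hωind w).le
      (measureReal_sum_gaussian_ge_le hξ hξind _ (fun t => hu s (w t)) hr) ENNReal.toReal_nonneg
      (Finset.prod_nonneg fun t _ => ENNReal.toReal_nonneg)
  calc _ ≤ _ := measureReal_mono hsub
    _ ≤ ∑ s, ∑ w : Fin m → ι, (∏ t, (p (w t)).toReal) * Real.exp (-r ^ 2 / (2 * m)) :=
        (measureReal_iUnion_fintype_le _).trans <| Finset.sum_le_sum fun s _ =>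
          (measureReal_iUnion_fintype_le _).trans <| Finset.sum_le_sum fun w _ => hterm s w
    _ = _ := by
        have h1 : ∑ w : Fin m → ι, ∏ t, (p (w t)).toReal = 1 := by
          rw [← Fintype.sum_pow (fun i => (p i).toReal) m, sum_toReal_pmf, one_pow]
        simp [← Finset.sum_mul, h1]

lemma measureReal_sum_mean_sub_sq_ge_le [Fintype ι] [IsProbabilityMeasure P]
    (hω : ∀ t, HasLaw (ω t) p.toMeasure P) (hind : iIndepFun ω P) {T : ι → ℝ} {α : ℝ}
    (hT : ∀ i, |T i| ≤ α) {r : ℝ} (hr : 0 ≤ r) :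
    P.real {x | r ≤ ∑ t, (∑ i, (p i).toReal * T i ^ 2 - T (ω t x) ^ 2)} ≤
      Real.exp (-r ^ 2 / (2 * (m * (α ^ 2 / 2) ^ 2))) := by
  have hmean : ∀ t, ∫ x, -T (ω t x) ^ 2 ∂P = -∑ i, (p i).toReal * T i ^ 2 := by
    intro t
    have := (hω t).integral_comp (f := fun i => -T i ^ 2)
      (measurable_of_finite _).aestronglyMeasurable
    simp only [Function.comp_def] at this
    rw [this, PMF.integral_eq_sum]
    simp
  have hsub : ∀ t, HasSubgaussianMGF (fun x => ∑ i, (p i).toReal * T i ^ 2 - T (ω t x) ^ 2)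
      ((‖(0 : ℝ) - -α ^ 2‖₊ / 2) ^ 2) P := by
    intro t
    have h := hasSubgaussianMGF_of_mem_Icc (μ := P) (X := fun x => -T (ω t x) ^ 2)
      (a := -α ^ 2) (b := 0)
      ((measurable_of_finite fun i => -T i ^ 2).comp_aemeasurable (hω t).aemeasurable)
      (Filter.Eventually.of_forall fun x => ⟨neg_le_neg (sq_le_sq' (abs_le.1 (hT _)).1
        (abs_le.1 (hT _)).2), neg_nonpos.2 (sq_nonneg _)⟩)
    refine h.congr (Filter.Eventually.of_forall fun x => ?_)
    simp only [hmean]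
    ring
  have hind' : iIndepFun (fun t x => ∑ i, (p i).toReal * T i ^ 2 - T (ω t x) ^ 2) P :=
    hind.comp (fun t i => ∑ i, (p i).toReal * T i ^ 2 - T i ^ 2) fun t => measurable_of_finite _
  have h := HasSubgaussianMGF.measure_sum_ge_le_of_iIndepFun hind' (s := Finset.univ)
    (fun t _ => hsub t) hr
  simpa using h

end Probability

/-! ### The error bound for the least-squares estimator -/

/-- The basic inequality: comparing the loss of the minimizer with that of `T` bounds the empirical
squared error by the noise tested against `X - T`, hence against sign tensors. -/
lemma sum_sq_sub_le_of_isMNormLSEstimator {d N m : ℕ} (hd : 1 ≤ d) (hN : 1 ≤ N) (hm : 1 ≤ m)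
    {α R σ g : ℝ} (hR : 0 ≤ R) (hσ : 0 ≤ σ) {T X : Tensor d N} (hT : ‖T‖ ≤ α) (hTR : mNorm T ≤ R)
    {w : Fin m → Fin d → Fin N} {z : Fin m → ℝ}
    (hg : ∀ s : Fin d → Fin N → ℤˣ, ∑ t, signTensor s (w t) * z t ≤ g)
    (hX : IsMNormLSEstimator α R w (fun t => observation T σ (w t) (z t)) X) :
    ∑ t, (X (w t) - T (w t)) ^ 2 ≤ 4 * σ * R * g := by
  obtain ⟨⟨hXα, hXR⟩, hmin⟩ := hX
  have h1 : empiricalLoss w (fun t => observation T σ (w t) (z t)) X ≤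
      empiricalLoss w (fun t => observation T σ (w t) (z t)) T := hmin ⟨hT, hTR⟩
  have hm' : (0 : ℝ) < 1 / m := by
    have : (0 : ℝ) < m := by exact_mod_cast hm
    positivity
  have h2 := le_of_mul_le_mul_left h1 hm'
  let ℓ : Tensor d N →ₗ[ℝ] ℝ := ∑ t, z t • LinearMap.proj (w t)
  have hℓ : ∀ Y, ℓ Y = ∑ t, Y (w t) * z t := by
    intro Y; simp [ℓ, mul_comm]
  have h3 : ∑ t, (X (w t) - T (w t)) ^ 2 ≤ 2 * σ * (ℓ X - ℓ T) := by
    have h4 : ∑ t, ((X (w t) - observation T σ (w t) (z t)) ^ 2 -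
        (T (w t) - observation T σ (w t) (z t)) ^ 2) =
        ∑ t, (X (w t) - T (w t)) ^ 2 - 2 * σ * (ℓ X - ℓ T) := by
      rw [hℓ, hℓ, ← Finset.sum_sub_distrib, Finset.mul_sum, ← Finset.sum_sub_distrib]
      refine Finset.sum_congr rfl fun t _ => ?_
      simp only [observation]
      ring
    rw [Finset.sum_sub_distrib] at h4
    linarith
  obtain ⟨s, hs⟩ := exists_signTensor_le hd hN ℓ
  obtain ⟨s', hs'⟩ := exists_signTensor_le hd hN (-ℓ)
  obtain ⟨s'', hs''⟩ := neg_signTensor hd s'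
  have hX' : ℓ X ≤ R * g :=
    (hs R X hXR).trans (mul_le_mul_of_nonneg_left ((hℓ _).trans_le (hg s)) hR)
  have hT' : -ℓ T ≤ R * g := by
    refine (hs' R T hTR).trans (mul_le_mul_of_nonneg_left ?_ hR)
    rw [LinearMap.neg_apply, ← map_neg, ← hs'', hℓ]
    exact hg s''
  nlinarith

/-- Deterministic part of the argument: on the intersection of the three events (noise, uniform
deviation of `(X - T)² - T²`, deviation of `T²`) the estimator has small weighted error. -/
lemma weightedSqNorm_sub_le {d N m : ℕ} (hd : 1 ≤ d) (hN : 1 ≤ N) (hm : 1 ≤ m)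
    {α R σ g r b : ℝ} (hR : 0 ≤ R) (hσ : 0 ≤ σ) (p : PMF (Fin d → Fin N)) {T X : Tensor d N}
    (hT : ‖T‖ ≤ α) (hTR : mNorm T ≤ R) {w : Fin m → Fin d → Fin N} {z : Fin m → ℝ}
    (hg : ∀ s : Fin d → Fin N → ℤˣ, ∑ t, signTensor s (w t) * z t ≤ g)
    (hr : w ∉ deviationSet (fun i => (p i).toReal) α R T m r)
    (hb : ∑ t, (∑ i, (p i).toReal * T i ^ 2 - T (w t) ^ 2) ≤ b)
    (hX : IsMNormLSEstimator α R w (fun t => observation T σ (w t) (z t)) X) :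
    m * weightedSqNorm p (X - T) ≤ m * r + b + 4 * σ * R * g := by
  have h1 := sum_sq_sub_le_of_isMNormLSEstimator hd hN hm hR hσ hT hTR hg hX
  have h2 : ∑ t, (∑ j, (p j).toReal * (X j ^ 2 - 2 * T j * X j) -
      (X (w t) ^ 2 - 2 * T (w t) * X (w t))) ≤ m * r := by
    by_contra! h
    exact hr ⟨X, hX.1, h⟩
  have h3 : weightedSqNorm p (X - T) = ∑ j, (p j).toReal * (X j ^ 2 - 2 * T j * X j) +
      ∑ i, (p i).toReal * T i ^ 2 := by
    rw [weightedSqNorm, ← Finset.sum_add_distrib]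
    refine Finset.sum_congr rfl fun i _ => ?_
    simp only [Pi.sub_apply]
    ring
  have h4 : m * weightedSqNorm p (X - T) =
      ∑ t, (∑ j, (p j).toReal * (X j ^ 2 - 2 * T j * X j) -
        (X (w t) ^ 2 - 2 * T (w t) * X (w t))) +
      ∑ t, (∑ i, (p i).toReal * T i ^ 2 - T (w t) ^ 2) + ∑ t, (X (w t) - T (w t)) ^ 2 := by
    have h5 : (m : ℝ) * weightedSqNorm p (X - T) = ∑ _t : Fin m, weightedSqNorm p (X - T) := by
      simp
    rw [h5, ← Finset.sum_add_distrib, ← Finset.sum_add_distrib]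
    refine Finset.sum_congr rfl fun t _ => ?_
    rw [h3]
    ring
  linarith

/-- The three failure probabilities add up to less than the admissible one. The base `2` of the
number of sign tensors is bounded by `e`; `2.645 - 1` must exceed `1 / log 2 = 1.4427…`. -/
lemma failure_probability_lt {d N : ℕ} (hd : 1 ≤ d) (hN : 2 ≤ N) :
    2 ^ (d * N) * Real.exp (-(8 * ((d : ℝ) * N))) +
      2 ^ (d * N) * Real.exp (-(2.645 * ((d : ℝ) * N))) + Real.exp (-(2 * ((d : ℝ) * N))) <
    Real.exp (-((N : ℝ) / Real.log N)) + Real.exp (-((d : ℝ) * N)) := by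
  have hN' : (2 : ℝ) ≤ N := by exact_mod_cast hN
  have hD : (N : ℝ) ≤ (d : ℝ) * N := by
    have : (1 : ℝ) ≤ d := by exact_mod_cast hd
    nlinarith
  have h2 : (2 : ℝ) ^ (d * N) ≤ Real.exp ((d : ℝ) * N) := by
    rw [← Nat.cast_mul, ← mul_one ((d * N : ℕ) : ℝ), Real.exp_nat_mul]
    exact pow_le_pow_left₀ (by norm_num) (by linarith [Real.add_one_le_exp 1]) _
  have hlog : 0.6931 < Real.log N :=
    (by norm_num; linarith [Real.log_two_gt_d9] : (0.6931 : ℝ) < Real.log 2).trans_le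
      (Real.log_le_log (by norm_num) hN')
  generalize (d : ℝ) * N = D at *
  have hNlog : (N : ℝ) / Real.log N ≤ 1.645 * D := by
    rw [div_le_iff₀ (by linarith)]
    nlinarith
  have hmul : ∀ c : ℝ, 2 ^ (d * N) * Real.exp (-(c * D)) ≤ Real.exp (-((c - 1) * D)) := by
    intro c
    refine (mul_le_mul_of_nonneg_right h2 (Real.exp_pos _).le).trans_eq ?_
    rw [← Real.exp_add]; congr 1; ring
  have h8 := hmul 8
  have hS := (hmul 2.645).trans (Real.exp_le_exp.2
    (show -((2.645 - 1) * D) ≤ -((N : ℝ) / Real.log N) by linarith))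
  have h7 : Real.exp (-((8 - 1) * D)) ≤ Real.exp (-(2 * D)) := Real.exp_le_exp.2 (by linarith)
  have hsq : Real.exp (-(2 * D)) = Real.exp (-D) ^ 2 := by
    rw [← Real.exp_nat_mul]; congr 1; push_cast; ring
  have hhalf : Real.exp (-D) < 1 / 2 := by
    rw [Real.exp_neg, inv_lt_comm₀ (Real.exp_pos _) (by norm_num)]
    linarith [Real.add_one_le_exp D]
  nlinarith [Real.exp_pos (-D)]

/-- Both conclusions follow from the single bound `19.4 (σ R + α R) √(dN / m)` for the weighted
error. -/
lemma exists_event_weightedSqNorm_le {d N m : ℕ} (hd : 1 ≤ d) (hN : 2 ≤ N) (hm : 1 ≤ m)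
    {α R σ : ℝ} (hαR : α ≤ R) (hσ : 0 < σ) {T : Tensor d N} (hT : ‖T‖ ≤ α) (hTR : mNorm T ≤ R)
    (p : PMF (Fin d → Fin N)) {Ω : Type*} [MeasurableSpace Ω] (P : Measure Ω)
    [IsProbabilityMeasure P] (ω : Fin m → Ω → (Fin d → Fin N)) (ξ : Fin m → Ω → ℝ)
    (hω : ∀ t, HasLaw (ω t) p.toMeasure P) (hωind : iIndepFun ω P)
    (hξ : ∀ t, HasLaw (ξ t) (gaussianReal 0 1) P) (hξind : iIndepFun ξ P)
    (hind : IndepFun (fun x t => ω t x) (fun x t => ξ t x) P) :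
    ∃ E : Set Ω, MeasurableSet E ∧
      1 - Real.exp (-((N : ℝ) / Real.log N)) - Real.exp (-((d : ℝ) * N)) < P.real E ∧
      ∀ x ∈ E, ∀ That : Tensor d N,
        IsMNormLSEstimator α R (fun t => ω t x)
          (fun t => observation T σ (ω t x) (ξ t x)) That →
        weightedSqNorm p (That - T) ≤
          19.4 * ((σ + α) * R) * Real.sqrt ((d : ℝ) * N / m) := by
  have hα0 : 0 ≤ α := (norm_nonneg T).trans hT
  have hN1 : 1 ≤ N := by omega
  have hR0 : 0 ≤ R := hα0.trans hαR
  have hm' : (0 : ℝ) < m := by exact_mod_cast hm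
  -- For `α = 0` both tensors vanish.
  rcases hα0.eq_or_lt with rfl | hα
  · refine ⟨Set.univ, MeasurableSet.univ, ?_, fun x _ That hThat => ?_⟩
    · rw [probReal_univ]
      linarith [Real.exp_pos (-((N : ℝ) / Real.log N)), Real.exp_pos (-((d : ℝ) * N))]
    · rw [norm_le_zero_iff.1 hT, norm_le_zero_iff.1 hThat.1.1]
      have : weightedSqNorm p (0 - 0) = 0 := by simp [weightedSqNorm]
      rw [this]
      positivity
  have hR : 0 < R := hα.trans_le hαR
  set q := √((d : ℝ) * N / m) with hq
  have hq0 : 0 ≤ q := Real.sqrt_nonneg _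
  have hq2 : m * q ^ 2 = (d : ℝ) * N := by
    rw [hq, Real.sq_sqrt (by positivity)]
    field_simp
  -- The failure events. The factor `18.4 = 8 * 2.3` in `B₂` gives the exponent
  -- `18.4 ^ 2 / 128 = 2.645`. None of them need be measurable, as `ω` and `ξ` are only
  -- a.e. measurable; the event `E` is the complement of a measurable hull of their union.
  let B₁ : Set Ω := {x | ∃ s : Fin d → Fin N → ℤˣ,
    m * (4 * q) ≤ ∑ t, signTensor s (ω t x) * ξ t x}
  let B₂ : Set Ω := {x | (fun t => ω t x) ∈
    deviationSet (fun i => (p i).toReal) α R T m (18.4 * α * R * q)}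
  let B₃ : Set Ω := {x | m * (α ^ 2 * q) ≤
    ∑ t, (∑ i, (p i).toReal * T i ^ 2 - T (ω t x) ^ 2)}
  have hB₁ : P.real B₁ ≤ 2 ^ (d * N) * Real.exp (-(8 * ((d : ℝ) * N))) := by
    refine (measureReal_exists_sum_noise_ge_le hω hωind hξ hξind hind
      (fun s : Fin d → Fin N → ℤˣ => signTensor s) signTensor_eq_one_or (by positivity)).trans_eq ?_
    congr 1
    · simp [pow_mul, mul_comm d N]
    · rw [← hq2]; congr 1; field_simp; ring
  have hB₂ : P.real B₂ ≤ 2 ^ (d * N) * Real.exp (-(2.645 * ((d : ℝ) * N))) := by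
    refine (measureReal_sample_mem_le hω hωind _).trans ((sum_deviationSet_le hd hN1 _
      (fun i => ENNReal.toReal_nonneg) (sum_toReal_pmf p) hα hR (by positivity) hT hTR
      m).trans_eq ?_)
    rw [← hq2]; congr 2; field_simp; ring
  have hB₃ : P.real B₃ ≤ Real.exp (-(2 * ((d : ℝ) * N))) := by
    refine (measureReal_sum_mean_sub_sq_ge_le hω hωind
      (fun i => abs_apply_le_of_norm_le hT i) (by positivity)).trans_eq ?_
    rw [← hq2]; congr 1; field_simp
  refine ⟨(toMeasurable P (B₁ ∪ B₂ ∪ B₃))ᶜ, (measurableSet_toMeasurable _ _).compl, ?_,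
    fun x hx That hThat => ?_⟩
  · have h1 : P.real (toMeasurable P (B₁ ∪ B₂ ∪ B₃)) ≤ P.real B₁ + P.real B₂ + P.real B₃ := by
      rw [Measure.real, measure_toMeasurable]
      exact (measureReal_union_le _ _).trans (add_le_add_left (measureReal_union_le _ _) _)
    rw [probReal_compl_eq_one_sub (measurableSet_toMeasurable _ _)]
    linarith [failure_probability_lt hd hN]
  · have hx' : x ∉ B₁ ∪ B₂ ∪ B₃ := fun h => hx (subset_toMeasurable _ _ h)
    simp only [Set.mem_union, not_or] at hx'
    obtain ⟨⟨hx₁, hx₂⟩, hx₃⟩ := hx'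
    have h1 := weightedSqNorm_sub_le hd hN1 hm hR0 hσ.le p hT hTR
      (fun s => (not_le.1 fun h => hx₁ ⟨s, h⟩).le) hx₂ (not_le.1 hx₃).le hThat
    have h2 : α ^ 2 * q ≤ α * R * q := by
      refine mul_le_mul_of_nonneg_right ?_ hq0
      nlinarith
    have h3 : 0 ≤ σ * R * q := by positivity
    refine le_of_mul_le_mul_left (h1.trans ?_) hm'
    have h4 : m * (18.4 * α * R * q) + m * (α ^ 2 * q) + 4 * σ * R * (m * (4 * q)) =
        m * (18.4 * α * R * q + α ^ 2 * q + 16 * σ * R * q) := by ring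
    rw [h4]
    exact mul_le_mul_of_nonneg_left (by linarith) hm'.le

theorem mainTheorem2 :
    ∃ C : ℝ, 0 < C ∧ C < 20 ∧
      ∀ (d N m : ℕ), 1 ≤ d → 2 ≤ N → 1 ≤ m →
      ∀ (α R σ : ℝ), α ≤ R → 0 < σ →
      ∀ (T : Tensor d N), ‖T‖ ≤ α → mNorm T ≤ R →
      ∀ (p : PMF (Fin d → Fin N))
        (Ω : Type*) [MeasurableSpace Ω] (P : Measure Ω) [IsProbabilityMeasure P]
        (ω : Fin m → Ω → (Fin d → Fin N)) (ξ : Fin m → Ω → ℝ),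
        (∀ t, HasLaw (ω t) p.toMeasure P) → iIndepFun ω P →
        (∀ t, HasLaw (ξ t) (gaussianReal 0 1) P) → iIndepFun ξ P →
        IndepFun (fun x t => ω t x) (fun x t => ξ t x) P →
        (∃ E : Set Ω, MeasurableSet E ∧
          1 - Real.exp (-((N : ℝ) / Real.log N)) - Real.exp (-((d : ℝ) * N)) < P.real E ∧
          ∀ x ∈ E, ∀ That : Tensor d N,
            IsMNormLSEstimator α R (fun t => ω t x)
              (fun t => observation T σ (ω t x) (ξ t x)) That →
            weightedSqNorm p (That - T) ≤
              C * (σ * (R + α) + R * α) * Real.sqrt ((d : ℝ) * N / m)) ∧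
        (∀ μ : ℝ, 1 ≤ μ → (∀ i, 1 / (μ * (N : ℝ) ^ d) ≤ (p i).toReal) → d * N < m →
          ∃ E : Set Ω, MeasurableSet E ∧
            1 - Real.exp (-((N : ℝ) / Real.log N)) - Real.exp (-((d : ℝ) * N)) < P.real E ∧
            ∀ x ∈ E, ∀ That : Tensor d N,
              IsMNormLSEstimator α R (fun t => ω t x)
                (fun t => observation T σ (ω t x) (ξ t x)) That →
              (1 / (N : ℝ) ^ d) * frobeniusSqNorm (That - T) ≤
                C * μ * (α + σ) * R * Real.sqrt ((d : ℝ) * N / m)) := by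
  refine ⟨19.4, by norm_num, by norm_num, ?_⟩
  intro d N m hd hN hm α R σ hαR hσ T hT hTR p Ω _ P _ ω ξ hω hωind hξ hξind hind
  have hα : 0 ≤ α := (norm_nonneg T).trans hT
  obtain ⟨E, hE, hPE, hbound⟩ := exists_event_weightedSqNorm_le hd hN hm hαR hσ hT hTR p P ω ξ
    hω hωind hξ hξind hind
  refine ⟨⟨E, hE, hPE, fun x hx That hThat => (hbound x hx That hThat).trans ?_⟩,
    fun μ hμ hp _ => ⟨E, hE, hPE, fun x hx That hThat => ?_⟩⟩
  · refine mul_le_mul_of_nonneg_right ?_ (Real.sqrt_nonneg _)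
    nlinarith
  · have hNd : (0 : ℝ) < (N : ℝ) ^ d := by
      have : (0 : ℝ) < N := by exact_mod_cast (by omega : 0 < N)
      positivity
    have h1 : (1 / (N : ℝ) ^ d) * frobeniusSqNorm (That - T) ≤
        μ * weightedSqNorm p (That - T) := by
      rw [frobeniusSqNorm, weightedSqNorm, Finset.mul_sum, Finset.mul_sum]
      refine Finset.sum_le_sum fun i _ => ?_
      rw [← mul_assoc]
      refine mul_le_mul_of_nonneg_right ?_ (sq_nonneg _)
      have h2 := mul_le_mul_of_nonneg_left (hp i) (by linarith : 0 ≤ μ)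
      refine le_of_eq_of_le ?_ h2
      have : μ ≠ 0 := by linarith
      field_simp
    refine h1.trans ((mul_le_mul_of_nonneg_left (hbound x hx That hThat) (by linarith)).trans_eq ?_)
    ring
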